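/- Let $B$ be a real separable Banach space with its Borel $\sigma$-algebra, and let $X, X_1, X_2, \dots$ be $B$-valued random variables on a probability space $(\Omega,\mathcal F,\mathbb P)$ such that $X_1, X_2, \dots$ are independent and each has the same distribution as $X$. Put $S_n = X_1 + \dots + X_n$ for $n \ge 1$. Suppose that there are positive integers $m_1 < m_2 < \cdots$ such that $S_{m_n}/\sqrt{m_n}$ converges weakly (to some Borel probability measure on $B$) as $n \to \infty$, but that the whole sequence $S_n/\sqrt n$ does not converge weakly to any Borel probability measure on $B$. Then, for every sequence $(a_n)_{n \ge 1}$ of positive real numbers, the sequence $S_n/a_n$ does not converge weakly to a non-degenerate Borel probability measure on $B$, that is, to one that is not a point mass. -/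

import Mathlib

open Filter MeasureTheory ProbabilityTheory

/-- The partial sum `S n` of the first `n` terms of a sequence of random vectors (the terms are
numbered from `0`, so `S n = X 0 + ... + X (n - 1)`). -/
def partialSum {Ω B : Type*} [AddCommMonoid B] (X : ℕ → Ω → B) (n : ℕ) (ω : Ω) : B :=
  ∑ i ∈ Finset.range n, X i ω

/-- The sequence `Y` of `B`-valued random variables on `(Ω, P)` converges weakly (in distribution)
to the Borel probability measure `ν` on `B`. -/
def ConvergesWeaklyTo {Ω B : Type*} [MeasurableSpace Ω] [TopologicalSpace B] [MeasurableSpace B]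
    [OpensMeasurableSpace B] (P : Measure Ω) [IsProbabilityMeasure P]
    (Y : ℕ → Ω → B) (ν : ProbabilityMeasure B) : Prop :=
  TendstoInDistribution Y atTop (id : B → B) (fun _ => P) (ν : Measure B)

/-- `Y` converges weakly to some Borel probability measure on `B`. -/
def ConvergesWeakly {Ω B : Type*} [MeasurableSpace Ω] [TopologicalSpace B] [MeasurableSpace B]
    [OpensMeasurableSpace B] (P : Measure Ω) [IsProbabilityMeasure P]
    (Y : ℕ → Ω → B) : Prop :=
  ∃ ν : ProbabilityMeasure B, ConvergesWeaklyTo P Y ν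

/-- The central limit theorem for (i.i.d. copies) `X 0, X 1, ...`:
`S n / √n` converges weakly. -/
def SatisfiesCLT {Ω B : Type*} [MeasurableSpace Ω] [NormedAddCommGroup B] [NormedSpace ℝ B]
    [MeasurableSpace B] [OpensMeasurableSpace B] (P : Measure Ω) [IsProbabilityMeasure P]
    (X : ℕ → Ω → B) : Prop :=
  ConvergesWeakly P (fun n ω => (Real.sqrt (n : ℝ))⁻¹ • partialSum X n ω)

/-- The central limit theorem for a subsequence: there are positive integers
`m 0 < m 1 < ...` such that `S (m n) / √(m n)` converges weakly. -/
def SatisfiesCLTSS {Ω B : Type*} [MeasurableSpace Ω] [NormedAddCommGroup B] [NormedSpace ℝ B]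
    [MeasurableSpace B] [OpensMeasurableSpace B] (P : Measure Ω) [IsProbabilityMeasure P]
    (X : ℕ → Ω → B) : Prop :=
  ∃ m : ℕ → ℕ, (∀ n, 0 < m n) ∧ StrictMono m ∧
    ConvergesWeakly P (fun n ω => (Real.sqrt (m n : ℝ))⁻¹ • partialSum X (m n) ω)

/-- A probability measure is non-degenerate if it is not a point mass. -/
def IsNondegenerate {B : Type*} [MeasurableSpace B] (ν : ProbabilityMeasure B) : Prop :=
  ∀ b : B, (ν : Measure B) ≠ Measure.dirac b

/-!
Convergence of `S_m / √m` along a subsequence forces every one-dimensional projection of `X` to be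
square integrable and centred: the characteristic function `φ` of the projection satisfies
`|φ (t / √m)| ^ m ≥ c > 0`, hence `1 - |φ s| ^ 2 = O (s ^ 2)` along `s = t / √m → 0`, and Fatou's
lemma applies to the symmetrization. If `S_n / a_n` had a non-degenerate limit, some functional `f`
would project that limit onto a law that is not a point mass. The scalar central limit theorem for
`f (X)` and convergence of types, which is decided on this single projection, then give
`√n / a_n → d > 0`, so that `S_n / √n` itself would converge by Slutsky's theorem.
-/

open scoped Topology

section SecondMoment

theorem natCast_mul_one_sub_le_neg_log {x c : ℝ} {n : ℕ} (hx : 0 ≤ x) (hc : 0 < c)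
    (h : c ≤ x ^ n) : n * (1 - x) ≤ -Real.log c := by
  have hpow : c ≤ Real.exp (-(n * (1 - x))) :=
    calc c ≤ x ^ n := h
      _ ≤ Real.exp (-(1 - x)) ^ n := by
          gcongr
          linarith [Real.one_sub_le_exp_neg (1 - x)]
      _ = Real.exp (-(n * (1 - x))) := by rw [← Real.exp_nat_mul, mul_neg]
  linarith [(Real.log_le_iff_le_exp hc).2 hpow]

theorem memLp_two_of_frequently_integral_one_sub_cos_le {α : Type*} [MeasurableSpace α]
    {μ : Measure α} [IsFiniteMeasure μ] {f : α → ℝ} (hf : AEMeasurable f μ) {C : ℝ}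
    (h : ∃ᶠ s in 𝓝[≠] (0 : ℝ), ∫ x, (1 - Real.cos (s * f x)) ∂μ ≤ C * s ^ 2) :
    MemLp f 2 μ := by
  let F : ℝ → α → ℝ := fun s x => (1 - Real.cos (s * f x)) / s ^ 2
  have hF0 : ∀ s x, 0 ≤ F s x := fun s x =>
    div_nonneg (sub_nonneg.2 (Real.cos_le_one _)) (sq_nonneg s)
  have hFint : ∀ s, Integrable (F s) μ := fun s =>
    ((integrable_const 1).sub (.of_bound (by fun_prop) 1
      (ae_of_all _ fun x => Real.abs_cos_le_one (s * f x)))).div_const _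
  have hF : ∀ x, ENNReal.ofReal (2 / Real.pi ^ 2 * f x ^ 2) ≤
      liminf (fun s => ENNReal.ofReal (F s x)) (𝓝[≠] 0) := by
    intro x
    have hcont : Continuous fun s : ℝ => |s * f x| := by fun_prop
    have hsmall : ∀ᶠ s in 𝓝[≠] (0 : ℝ), |s * f x| < Real.pi :=
      nhdsWithin_le_nhds ((hcont.tendsto' 0 0 (by simp)).eventually_lt_const Real.pi_pos)
    refine le_liminf_of_le (by isBoundedDefault) ?_
    filter_upwards [hsmall, self_mem_nhdsWithin] with s hs hs0
    refine ENNReal.ofReal_le_ofReal ((le_div_iff₀ (sq_pos_of_ne_zero hs0)).2 ?_)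
    linarith [Real.cos_le_one_sub_mul_cos_sq hs.le]
  have hfatou : ∫⁻ x, ENNReal.ofReal (2 / Real.pi ^ 2 * f x ^ 2) ∂μ ≤ ENNReal.ofReal C := by
    calc ∫⁻ x, ENNReal.ofReal (2 / Real.pi ^ 2 * f x ^ 2) ∂μ
        ≤ ∫⁻ x, liminf (fun s => ENNReal.ofReal (F s x)) (𝓝[≠] 0) ∂μ := lintegral_mono hF
      _ ≤ liminf (fun s => ∫⁻ x, ENNReal.ofReal (F s x) ∂μ) (𝓝[≠] 0) :=
          lintegral_liminf_le' fun s => by fun_prop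
      _ ≤ ENNReal.ofReal C := by
          refine liminf_le_of_frequently_le' ((h.and_eventually self_mem_nhdsWithin).mono ?_)
          rintro s ⟨hs, hs0⟩
          rw [← ofReal_integral_eq_lintegral_ofReal (hFint s) (ae_of_all _ (hF0 s)),
            integral_div]
          exact ENNReal.ofReal_le_ofReal ((div_le_iff₀ (sq_pos_of_ne_zero hs0)).2 hs)
  refine (memLp_two_iff_integrable_sq (by fun_prop)).2 ((integrable_const_mul_iff
    (IsUnit.mk0 (2 / Real.pi ^ 2) (by positivity)) _).1 ⟨by fun_prop, ?_⟩)
  rw [hasFiniteIntegral_iff_ofReal (ae_of_all _ fun x => by positivity)]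
  exact hfatou.trans_lt ENNReal.ofReal_lt_top

theorem integral_one_sub_cos_mul_sub_eq (μ : Measure ℝ) [IsProbabilityMeasure μ] (s : ℝ) :
    ∫ p : ℝ × ℝ, (1 - Real.cos (s * (p.1 - p.2))) ∂(μ.prod μ) = 1 - ‖charFun μ s‖ ^ 2 := by
  let g : ℝ × ℝ → ℂ := fun p => Complex.exp ((s * (p.1 - p.2) : ℝ) * Complex.I)
  have hg : Integrable g (μ.prod μ) :=
    .of_bound (by fun_prop) 1 (ae_of_all _ fun p => (Complex.norm_exp_ofReal_mul_I _).le)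
  have hg_re : ∀ p, Real.cos (s * (p.1 - p.2)) = RCLike.re (g p) := fun p =>
    (Complex.exp_ofReal_mul_I_re _).symm
  have hprod : ∫ p, g p ∂(μ.prod μ) = ((‖charFun μ s‖ ^ 2 : ℝ) : ℂ) :=
    calc ∫ p, g p ∂(μ.prod μ)
        = ∫ p : ℝ × ℝ, Complex.exp (s * p.1 * Complex.I) *
            Complex.exp ((-s : ℝ) * p.2 * Complex.I) ∂(μ.prod μ) := by
          refine integral_congr_ae (ae_of_all _ fun p => ?_)
          simp only [g, ← Complex.exp_add]
          push_cast
          ring_nf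
      _ = charFun μ s * charFun μ (-s) := by
          simp only [charFun_apply_real]
          exact integral_prod_mul (fun x : ℝ => Complex.exp (s * x * Complex.I))
            fun y : ℝ => Complex.exp ((-s : ℝ) * y * Complex.I)
      _ = ((‖charFun μ s‖ ^ 2 : ℝ) : ℂ) := by
          rw [charFun_neg, Complex.mul_conj', Complex.ofReal_pow]
  have hcos : ∫ p : ℝ × ℝ, Real.cos (s * (p.1 - p.2)) ∂(μ.prod μ) = ‖charFun μ s‖ ^ 2 := by
    simp only [hg_re]
    rw [integral_re hg, hprod, RCLike.re_eq_complex_re, Complex.ofReal_re]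
  rw [integral_sub (integrable_const 1) (by simpa only [hg_re] using hg.re), hcos,
    integral_const, probReal_univ, one_smul]

theorem memLp_of_memLp_prod_sub {α β E : Type*} [MeasurableSpace α] [MeasurableSpace β]
    [NormedAddCommGroup E] {μ : Measure α} [IsFiniteMeasure μ] {ν : Measure β} [SFinite ν]
    [NeZero ν] {p : ENNReal} (hp0 : p ≠ 0) (hp : p ≠ ⊤) {f : α → E} {g : β → E}
    (hf : AEStronglyMeasurable f μ)
    (h : MemLp (fun q : α × β => f q.1 - g q.2) p (μ.prod ν)) : MemLp f p μ := by
  obtain ⟨y, hy⟩ := ((integrable_norm_rpow_iff h.1 hp0 hp).2 h).prod_left_ae.exists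
  have hsub : MemLp (fun x => f x - g y) p μ :=
    (integrable_norm_rpow_iff (hf.sub aestronglyMeasurable_const) hp0 hp).1 hy
  simpa only [Pi.add_def, sub_add_cancel] using hsub.add (memLp_const (g y))

theorem memLp_two_id_of_frequently_one_sub_norm_charFun_sq_le {μ : Measure ℝ}
    [IsProbabilityMeasure μ] {C : ℝ}
    (h : ∃ᶠ s in 𝓝[≠] (0 : ℝ), 1 - ‖charFun μ s‖ ^ 2 ≤ C * s ^ 2) : MemLp id 2 μ := by
  simp only [← integral_one_sub_cos_mul_sub_eq] at h
  exact memLp_of_memLp_prod_sub two_ne_zero ENNReal.ofNat_ne_top aestronglyMeasurable_id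
    (g := id) (memLp_two_of_frequently_integral_one_sub_cos_le (by fun_prop) h)

theorem memLp_two_id_of_tendsto_charFun_pow {μ : Measure ℝ} [IsProbabilityMeasure μ]
    {m : ℕ → ℕ} (hm : Tendsto m atTop atTop) {t : ℝ} (ht : t ≠ 0) {z : ℂ} (hz : z ≠ 0)
    (h : Tendsto (fun n => charFun μ ((√(m n))⁻¹ * t) ^ m n) atTop (𝓝 z)) :
    MemLp id 2 μ := by
  obtain ⟨c, hc0, hcz⟩ := exists_between (sq_pos_of_pos (norm_pos_iff.2 hz))
  have hlow : ∀ᶠ n in atTop, c < (‖charFun μ ((√(m n))⁻¹ * t)‖ ^ 2) ^ m n := by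
    filter_upwards [(h.norm.pow 2).eventually_const_lt hcz] with n hn
    rwa [pow_right_comm, ← norm_pow]
  have hm0 : ∀ᶠ n in atTop, 0 < √(m n : ℝ) := by
    filter_upwards [hm.eventually_gt_atTop 0] with n hn
    exact Real.sqrt_pos.2 (Nat.cast_pos.2 hn)
  have hs : Tendsto (fun n => (√(m n : ℝ))⁻¹ * t) atTop (𝓝[≠] 0) := by
    have hsqrt := Real.tendsto_sqrt_atTop.comp (tendsto_natCast_atTop_atTop.comp hm)
    refine tendsto_nhdsWithin_iff.2 ⟨?_, hm0.mono fun n hn => mul_ne_zero (inv_pos.2 hn).ne' ht⟩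
    simpa only [zero_mul, Function.comp_def] using
      (tendsto_inv_atTop_zero.comp hsqrt).mul_const t
  refine memLp_two_id_of_frequently_one_sub_norm_charFun_sq_le (C := -Real.log c / t ^ 2)
    (hs.frequently (Eventually.frequently ?_))
  filter_upwards [hlow, hm0] with n hn hn0
  have hlog := natCast_mul_one_sub_le_neg_log (sq_nonneg _) hc0 hn.le
  have hmn : (0 : ℝ) < m n := Real.sqrt_pos.1 hn0
  calc 1 - ‖charFun μ ((√(m n))⁻¹ * t)‖ ^ 2 ≤ -Real.log c / m n := by
        rwa [le_div_iff₀' hmn]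
    _ = -Real.log c / t ^ 2 * ((√(m n))⁻¹ * t) ^ 2 := by
        rw [mul_pow, inv_pow, Real.sq_sqrt hmn.le]
        field_simp

end SecondMoment

theorem exists_dual_map_ne_dirac {E : Type*} [AddCommGroup E] [Module ℝ E] [TopologicalSpace E]
    [SeparatingDual ℝ E] [HereditarilyLindelofSpace E] [MeasurableSpace E]
    [OpensMeasurableSpace E] {ν : Measure E} [IsProbabilityMeasure ν]
    (hν : ∀ b, ν ≠ Measure.dirac b) :
    ∃ f : StrongDual ℝ E, ∀ c : ℝ, ν.map f ≠ Measure.dirac c := by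
  by_contra! h
  obtain ⟨b, hb⟩ := Measure.nonempty_support (IsProbabilityMeasure.ne_zero ν)
  have hconst : ∀ f : StrongDual ℝ E, ∀ x ∈ ν.support, f x = f b := by
    intro f x hx
    obtain ⟨c, hc⟩ := h f
    have hfc : ∀ᵐ x ∂ν, f x = c := by
      refine ae_of_ae_map (p := (· = c)) f.continuous.measurable.aemeasurable ?_
      rw [hc, ae_dirac_eq]
      rfl
    have hsub := Measure.support_subset_of_isClosed (isClosed_eq f.continuous continuous_const) hfc
    exact (hsub hx).trans (hsub hb).symm
  have hsupp : ∀ x ∈ ν.support, x = b := fun x hx =>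
    (SeparatingDual.eq_iff_forall_dual_eq (R := ℝ)).2 fun f => hconst f x hx
  have hae : id =ᵐ[ν] fun _ => b := by
    filter_upwards [Measure.support_mem_ae] with x hx using hsupp x hx
  exact hν b (Measure.map_id.symm.trans (hasLaw_dirac_of_ae_eq hae).map_eq)

section ConvergenceInDistribution

theorem tendstoInDistribution_comp_tendsto {ι κ E Ω' : Type*} {Ω : ι → Type*}
    [∀ i, MeasurableSpace (Ω i)] {P : ∀ i, Measure (Ω i)} [∀ i, IsProbabilityMeasure (P i)]
    [MeasurableSpace Ω'] {P' : Measure Ω'} [IsProbabilityMeasure P'] [TopologicalSpace E]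
    [MeasurableSpace E] [OpensMeasurableSpace E] {T : ∀ i, Ω i → E} {Z : Ω' → E} {l : Filter ι}
    (h : TendstoInDistribution T l Z P P') {φ : κ → ι} {l' : Filter κ} (hφ : Tendsto φ l' l) :
    TendstoInDistribution (fun k => T (φ k)) l' Z (fun k => P (φ k)) P' where
  forall_aemeasurable k := h.forall_aemeasurable (φ k)
  aemeasurable_limit := h.aemeasurable_limit
  tendsto := h.tendsto.comp hφ

variable {E : Type*} [NormedAddCommGroup E] [NormedSpace ℝ E] [MeasurableSpace E] [BorelSpace E]

theorem eq_dirac_zero_of_map_smul_eq_self {ν : Measure E} [IsProbabilityMeasure ν] {r : ℝ}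
    (hr : |r| < 1) (h : ν.map (fun x => r • x) = ν) : ν = Measure.dirac 0 := by
  have hpow : ∀ k : ℕ, ν.map (fun x => r ^ k • x) = ν := by
    intro k
    induction k with
    | zero => simp only [pow_zero, one_smul, Measure.map_id']
    | succ k ih =>
      have hcomp : (fun x : E => r ^ (k + 1) • x) = (fun x => r ^ k • x) ∘ fun x => r • x := by
        ext x
        simp only [Function.comp_apply, smul_smul, pow_succ]
      rw [hcomp, ← Measure.map_map (by fun_prop) (by fun_prop), h, ih]
  have hzero : TendstoInDistribution (fun (k : ℕ) (x : E) => r ^ k • x) atTop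
      (fun _ => (0 : E)) (fun _ => ν) ν := by
    refine tendstoInDistribution_of_ae_tendsto (fun k => by fun_prop) aemeasurable_const
      (ae_of_all _ fun x => ?_)
    simpa only [zero_smul] using (tendsto_pow_atTop_nhds_zero_of_abs_lt_one hr).smul_const x
  have hid : ∀ k : ℕ, IdentDistrib (fun x : E => r ^ k • x) id ν ν := fun k =>
    ⟨by fun_prop, aemeasurable_id, (hpow k).trans Measure.map_id.symm⟩
  have hconst : TendstoInDistribution (fun (k : ℕ) (x : E) => r ^ k • x) atTop id
      (fun _ => ν) ν :=
    tendstoInDistribution_of_identDistrib 0 (fun k => (hid 0).trans (hid k).symm) (hid 0)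
  simpa only [Measure.map_id, Measure.map_const, measure_univ, one_smul] using
    tendstoInDistribution_unique _ hconst hzero

theorem abs_eq_abs_of_map_smul_eq_map_smul {ν : Measure E} [IsProbabilityMeasure ν]
    (hν : ν ≠ Measure.dirac 0) {c d : ℝ}
    (h : ν.map (fun x => c • x) = ν.map (fun x => d • x)) : |c| = |d| := by
  wlog hcd : |c| < |d| generalizing c d
  · by_contra hne
    exact hne (this h.symm (lt_of_le_of_ne (not_lt.1 hcd) (Ne.symm hne))).symm
  have hd : d ≠ 0 := abs_pos.1 ((abs_nonneg c).trans_lt hcd)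
  refine absurd (eq_dirac_zero_of_map_smul_eq_self (r := d⁻¹ * c) ?_ ?_) hν
  · rwa [abs_mul, abs_inv, inv_mul_lt_one₀ (abs_pos.2 hd)]
  · calc ν.map (fun x => (d⁻¹ * c) • x) = (ν.map fun x => c • x).map fun x => d⁻¹ • x := by
          rw [Measure.map_map (by fun_prop) (by fun_prop)]
          simp only [Function.comp_def, smul_smul]
      _ = (ν.map fun x => d • x).map fun x => d⁻¹ • x := by rw [h]
      _ = ν := by
          rw [Measure.map_map (by fun_prop) (by fun_prop)]
          simp only [Function.comp_def, inv_smul_smul₀ hd, Measure.map_id']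

variable [SecondCountableTopology E]
  {Ω Ω' Ω'' : Type*} [MeasurableSpace Ω] [MeasurableSpace Ω'] [MeasurableSpace Ω'']
  {P : Measure Ω} [IsProbabilityMeasure P] {P' : Measure Ω'} [IsProbabilityMeasure P']
  {P'' : Measure Ω''} [IsProbabilityMeasure P'']

theorem tendstoInDistribution_smul_of_tendsto {T : ℕ → Ω → E} {Z : Ω' → E}
    (h : TendstoInDistribution T atTop Z (fun _ => P) P') {c : ℕ → ℝ} {d : ℝ}
    (hc : Tendsto c atTop (𝓝 d)) :
    TendstoInDistribution (fun n ω => c n • T n ω) atTop (fun ω => d • Z ω) (fun _ => P) P' := by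
  refine h.continuous_comp_prodMk_of_tendstoInMeasure_const (g := fun p : E × ℝ => p.2 • p.1)
    (by fun_prop) (Y := fun n _ => c n) (c := d) ?_ fun n => aemeasurable_const
  exact tendstoInMeasure_of_tendsto_ae (fun n => aestronglyMeasurable_const)
    (ae_of_all _ fun _ => hc)

variable {T : ℕ → Ω → E} {Z : Ω' → E} {Z' : Ω'' → E} {e : ℕ → ℝ}

theorem exists_eventually_abs_le_of_tendstoInDistribution_smul
    (hT : TendstoInDistribution T atTop Z (fun _ => P) P') (hZ : P'.map Z ≠ Measure.dirac 0)
    (hU : TendstoInDistribution (fun n ω => e n • T n ω) atTop Z' (fun _ => P) P'') :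
    ∃ M, ∀ᶠ n in atTop, |e n| ≤ M := by
  by_contra! h
  obtain ⟨φ, hφ, hφe⟩ := extraction_forall_of_frequently
    (P := fun k n => (k : ℝ) < |e n|) fun k => by simpa only [not_eventually, not_le] using h k
  have hinv : Tendsto (fun k => (e (φ k))⁻¹) atTop (𝓝 0) := by
    refine tendsto_inv₀_cobounded.comp (tendsto_norm_atTop_iff_cobounded.1 ?_)
    exact tendsto_atTop_mono (fun k => (hφe k).le) tendsto_natCast_atTop_atTop
  have hzero := (tendstoInDistribution_smul_of_tendsto
    (tendstoInDistribution_comp_tendsto hU hφ.tendsto_atTop) hinv).congr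
      (Y := fun k => T (φ k)) (fun k => ae_of_all _ fun ω => inv_smul_smul₀
        (abs_pos.1 ((Nat.cast_nonneg k).trans_lt (hφe k))) _) (ae_eq_refl _)
  refine hZ ?_
  simpa only [zero_smul, Measure.map_const, measure_univ, one_smul] using
    tendstoInDistribution_unique _ (tendstoInDistribution_comp_tendsto hT hφ.tendsto_atTop) hzero

theorem exists_pos_tendsto_abs_of_tendstoInDistribution_smul
    (hT : TendstoInDistribution T atTop Z (fun _ => P) P') (hZ : P'.map Z ≠ Measure.dirac 0)
    (hU : TendstoInDistribution (fun n ω => e n • T n ω) atTop Z' (fun _ => P) P'')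
    (hZ' : P''.map Z' ≠ Measure.dirac 0) :
    ∃ d > 0, Tendsto (fun n => |e n|) atTop (𝓝 d) := by
  have hlaw : ∀ {φ : ℕ → ℕ} {d : ℝ}, Tendsto φ atTop atTop →
      Tendsto (fun k => e (φ k)) atTop (𝓝 d) → P''.map Z' = (P'.map Z).map fun x => d • x := by
    intro φ d hφ hd
    rw [AEMeasurable.map_map_of_aemeasurable (by fun_prop) hT.aemeasurable_limit]
    exact tendstoInDistribution_unique _ (tendstoInDistribution_comp_tendsto hU hφ)
      (tendstoInDistribution_smul_of_tendsto (tendstoInDistribution_comp_tendsto hT hφ) hd)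
  have : IsProbabilityMeasure (P'.map Z) := Measure.isProbabilityMeasure_map hT.aemeasurable_limit
  obtain ⟨M, hM⟩ := exists_eventually_abs_le_of_tendstoInDistribution_smul hT hZ hU
  have hIcc : ∀ᶠ n in atTop, e n ∈ Set.Icc (-M) M := hM.mono fun n hn => abs_le.1 hn
  obtain ⟨d, -, φ, hφ, hd⟩ := isCompact_Icc.tendsto_subseq' hIcc.frequently
  have hd0 : d ≠ 0 := by
    rintro rfl
    refine hZ' ((hlaw hφ.tendsto_atTop hd).trans ?_)
    simp only [zero_smul, Measure.map_const, measure_univ, one_smul]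
  refine ⟨|d|, abs_pos.2 hd0, tendsto_of_subseq_tendsto fun ψ hψ => ?_⟩
  obtain ⟨c, -, χ, hχ, hc⟩ := isCompact_Icc.tendsto_subseq' (hψ.eventually hIcc).frequently
  have hcd : |c| = |d| := abs_eq_abs_of_map_smul_eq_map_smul hZ
    ((hlaw (hψ.comp hχ.tendsto_atTop) hc).symm.trans (hlaw hφ.tendsto_atTop hd))
  exact ⟨χ, hcd ▸ hc.abs⟩

end ConvergenceInDistribution

section PartialSum

variable {Ω Ω' : Type*} [MeasurableSpace Ω] [MeasurableSpace Ω']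
  {P : Measure Ω} [IsProbabilityMeasure P] {P' : Measure Ω'} [IsProbabilityMeasure P']

theorem ConvergesWeakly.of_tendstoInDistribution {E : Type*} [TopologicalSpace E]
    [MeasurableSpace E] [OpensMeasurableSpace E] {Y : ℕ → Ω → E} {Z : Ω' → E}
    (h : TendstoInDistribution Y atTop Z (fun _ => P) P') : ConvergesWeakly P Y := by
  let ν : ProbabilityMeasure E :=
    ⟨P'.map Z, Measure.isProbabilityMeasure_map h.aemeasurable_limit⟩
  refine ⟨ν, h.forall_aemeasurable, aemeasurable_id, ?_⟩
  simpa only [ν, ProbabilityMeasure.coe_mk, Measure.map_id] using h.tendsto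

section NormedSpace

variable {E : Type*} [NormedAddCommGroup E] [NormedSpace ℝ E] [MeasurableSpace E]

theorem tendstoInDistribution_smul_partialSum_continuousLinearMap [OpensMeasurableSpace E]
    {F : Type*} [NormedAddCommGroup F] [NormedSpace ℝ F] [MeasurableSpace F] [BorelSpace F]
    {ι : Type*} {l : Filter ι} {X : ℕ → Ω → E} {Z : Ω' → E} {c : ι → ℝ} {m : ι → ℕ}
    (h : TendstoInDistribution (fun n ω => c n • partialSum X (m n) ω) l Z (fun _ => P) P')
    (f : E →L[ℝ] F) :
    TendstoInDistribution (fun n ω => c n • partialSum (fun i ω => f (X i ω)) (m n) ω) l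
      (fun ω => f (Z ω)) (fun _ => P) P' := by
  simpa only [partialSum, Function.comp_def, map_smul, map_sum] using
    h.continuous_comp f.continuous

theorem SatisfiesCLTSS.continuousLinearMap_comp [OpensMeasurableSpace E] {F : Type*}
    [NormedAddCommGroup F] [NormedSpace ℝ F] [MeasurableSpace F] [BorelSpace F] {X : ℕ → Ω → E}
    (h : SatisfiesCLTSS P X) (f : E →L[ℝ] F) : SatisfiesCLTSS P fun i ω => f (X i ω) := by
  obtain ⟨m, hm0, hm, ν, hν⟩ := h
  exact ⟨m, hm0, hm, .of_tendstoInDistribution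
    (tendstoInDistribution_smul_partialSum_continuousLinearMap hν f)⟩

variable [BorelSpace E] [SecondCountableTopology E] {X : ℕ → Ω → E}

theorem SatisfiesCLTSS.integral_eq_zero [CompleteSpace E]
    (hX : SatisfiesCLTSS P X) (hint : Integrable (X 0) P) (hindep : iIndepFun X P)
    (hident : ∀ i, IdentDistrib (X i) (X 0) P P) : P[X 0] = 0 := by
  obtain ⟨m, -, hm, ν, hν⟩ := hX
  have hmean : TendstoInDistribution (fun n ω => (√(m n))⁻¹ • (√(m n))⁻¹ • partialSum X (m n) ω)
      atTop (fun _ => P[X 0]) (fun _ => P) P := by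
    refine tendstoInDistribution_of_ae_tendsto
      (fun n => (hν.forall_aemeasurable n).const_smul _) aemeasurable_const ?_
    filter_upwards [strong_law_ae X hint (fun i j hij => hindep.indepFun hij) hident] with ω hω
    simpa only [Function.comp_def, smul_smul, ← mul_inv, Real.mul_self_sqrt (Nat.cast_nonneg _),
      partialSum] using hω.comp hm.tendsto_atTop
  have hzero := tendstoInDistribution_smul_of_tendsto hν (tendsto_inv_atTop_zero.comp
    (Real.tendsto_sqrt_atTop.comp (tendsto_natCast_atTop_atTop.comp hm.tendsto_atTop)))
  refine dirac_eq_dirac_iff.1 ?_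
  simpa only [zero_smul, Measure.map_const, measure_univ, one_smul] using
    tendstoInDistribution_unique _ hmean hzero

theorem satisfiesCLT_of_tendsto_mul_sqrt {c : ℕ → ℝ} (hc : ∀ n, 0 < n → c n ≠ 0)
    {Z : Ω' → E}
    (h : TendstoInDistribution (fun n ω => c n • partialSum X n ω) atTop Z (fun _ => P) P')
    {d : ℝ} (hd : d ≠ 0) (hcd : Tendsto (fun n => c n * √n) atTop (𝓝 d)) : SatisfiesCLT P X := by
  refine .of_tendstoInDistribution ((tendstoInDistribution_smul_of_tendsto h (hcd.inv₀ hd)).congr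
    (fun n => ae_of_all _ fun ω => ?_) (ae_eq_refl _))
  rcases n.eq_zero_or_pos with rfl | hn
  · simp only [partialSum, Finset.range_zero, Finset.sum_empty, smul_zero]
  · simp only [mul_inv_rev, smul_smul, inv_mul_cancel_right₀ (hc n hn)]

end NormedSpace

section Real

variable {X : ℕ → Ω → ℝ}

theorem SatisfiesCLTSS.memLp_two (hX : SatisfiesCLTSS P X) (hindep : iIndepFun X P)
    (hident : ∀ i, IdentDistrib (X i) (X 0) P P) : MemLp (X 0) 2 P := by
  obtain ⟨m, -, hm, ν, hν⟩ := hX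
  have hX0 : AEMeasurable (X 0) P := (hident 0).aemeasurable_fst
  have : IsProbabilityMeasure (P.map (X 0)) := Measure.isProbabilityMeasure_map hX0
  have hne : ∀ᶠ t in 𝓝[≠] (0 : ℝ), charFun ν.toMeasure t ≠ 0 :=
    nhdsWithin_le_nhds (continuous_charFun.continuousAt.eventually_ne (by simp))
  obtain ⟨t, hνt, ht⟩ := (hne.and self_mem_nhdsWithin).exists
  have hlim : Tendsto (fun n => charFun (P.map (X 0)) ((√(m n))⁻¹ * t) ^ m n) atTop
      (𝓝 (charFun ν.toMeasure t)) := by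
    simp only [← charFun_inv_sqrt_mul_sum hindep hident]
    simpa only [ProbabilityMeasure.coe_mk, Measure.map_id, partialSum, smul_eq_mul] using
      ProbabilityMeasure.tendsto_iff_tendsto_charFun.1 hν.tendsto t
  exact (memLp_map_measure_iff aestronglyMeasurable_id hX0).1
    (memLp_two_id_of_tendsto_charFun_pow hm.tendsto_atTop ht hνt hlim)

variable {Z : Ω' → ℝ} {c : ℕ → ℝ}

theorem variance_ne_zero_of_tendstoInDistribution_smul_partialSum
    (hident : ∀ i, IdentDistrib (X i) (X 0) P P) (hL2 : MemLp (X 0) 2 P) (hmean : P[X 0] = 0)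
    (h : TendstoInDistribution (fun n ω => c n • partialSum X n ω) atTop Z (fun _ => P) P')
    (hZ : P'.map Z ≠ Measure.dirac 0) : Var[X 0; P] ≠ 0 := by
  intro hvar
  have hX0 : ∀ i, X i =ᵐ[P] 0 := fun i => by
    have hi := ae_eq_integral_of_variance_eq_zero ((hident i).memLp_iff.2 hL2)
      ((hident i).variance_eq.trans hvar)
    rwa [(hident i).integral_eq, hmean] at hi
  have hzero : TendstoInDistribution (fun n ω => c n • partialSum X n ω) atTop
      (fun _ => (0 : ℝ)) (fun _ => P) P := by
    refine (tendstoInDistribution_const aemeasurable_const).congr (fun n => ?_) (ae_eq_refl _)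
    filter_upwards [ae_all_iff.2 hX0] with ω hω
    simp only [partialSum, hω, Pi.zero_apply, Finset.sum_const_zero, smul_zero]
  refine hZ ?_
  simpa only [Measure.map_const, measure_univ, one_smul] using
    tendstoInDistribution_unique _ h hzero

theorem exists_pos_tendsto_abs_mul_sqrt_of_tendstoInDistribution_smul_partialSum
    (hindep : iIndepFun X P) (hident : ∀ i, IdentDistrib (X i) (X 0) P P)
    (hL2 : MemLp (X 0) 2 P) (hmean : P[X 0] = 0)
    (h : TendstoInDistribution (fun n ω => c n • partialSum X n ω) atTop Z (fun _ => P) P')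
    (hZ : P'.map Z ≠ Measure.dirac 0) :
    ∃ d > 0, Tendsto (fun n => |c n * √n|) atTop (𝓝 d) := by
  have hvar := variance_ne_zero_of_tendstoInDistribution_smul_partialSum hident hL2 hmean h hZ
  have hclt : TendstoInDistribution (fun (n : ℕ) ω => (√n)⁻¹ • partialSum X n ω) atTop id
      (fun _ => P) (gaussianReal 0 Var[X 0; P].toNNReal) := by
    simpa only [hmean, mul_zero, sub_zero, partialSum, smul_eq_mul] using
      tendstoInDistribution_inv_sqrt_mul_sum_sub HasLaw.id hL2 hindep hident
  refine exists_pos_tendsto_abs_of_tendstoInDistribution_smul hclt ?_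
    (h.congr (fun n => ae_of_all _ fun ω => ?_) (ae_eq_refl _)) hZ
  · rw [Measure.map_id, ← gaussianReal_zero_var, Ne, gaussianReal_ext_iff]
    exact fun hg => hvar
      (le_antisymm (Real.toNNReal_eq_zero.1 hg.2) (variance_nonneg _ _))
  · rcases n.eq_zero_or_pos with rfl | hn
    · simp only [partialSum, Finset.range_zero, Finset.sum_empty, smul_zero]
    · have hsqrt : √(n : ℝ) ≠ 0 := (Real.sqrt_pos.2 (Nat.cast_pos.2 hn)).ne'
      simp only [smul_smul, mul_inv_cancel_right₀ hsqrt]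

end Real

end PartialSum

theorem theorem2_general {B : Type*} [NormedAddCommGroup B] [NormedSpace ℝ B]
    [TopologicalSpace.SeparableSpace B] [MeasurableSpace B] [BorelSpace B]
    {Ω : Type*} [MeasurableSpace Ω] (P : Measure Ω) [IsProbabilityMeasure P] (Xs : ℕ → Ω → B)
    (hindep : iIndepFun Xs P) (hident : ∀ n, IdentDistrib (Xs n) (Xs 0) P P)
    (hCLTSS : ∀ f : StrongDual ℝ B, SatisfiesCLTSS P fun n ω => f (Xs n ω))
    (hCLT : ¬ SatisfiesCLT P Xs) (a : ℕ → ℝ) (ha : ∀ n, 0 < n → 0 < a n) :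
    ¬ ∃ ν : ProbabilityMeasure B, IsNondegenerate ν ∧
      ConvergesWeaklyTo P (fun n ω => (a n)⁻¹ • partialSum Xs n ω) ν := by
  rintro ⟨ν, hν, hconv⟩
  have : SecondCountableTopology B := UniformSpace.secondCountable_of_separable B
  obtain ⟨f, hf⟩ := exists_dual_map_ne_dirac hν
  have hf_indep : iIndepFun (fun n ω => f (Xs n ω)) P :=
    hindep.comp (fun _ => f) fun _ => f.measurable
  have hf_ident : ∀ n, IdentDistrib (fun ω => f (Xs n ω)) (fun ω => f (Xs 0 ω)) P P :=
    fun n => (hident n).comp f.measurable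
  have hL2 := (hCLTSS f).memLp_two hf_indep hf_ident
  have hmean := (hCLTSS f).integral_eq_zero (hL2.integrable one_le_two) hf_indep hf_ident
  obtain ⟨d, hd0, hd⟩ :=
    exists_pos_tendsto_abs_mul_sqrt_of_tendstoInDistribution_smul_partialSum hf_indep hf_ident
      hL2 hmean (tendstoInDistribution_smul_partialSum_continuousLinearMap hconv f) (hf 0)
  have hsqrt : ∀ n : ℕ, |(a n)⁻¹ * √n| = (a n)⁻¹ * √n := fun n => by
    rcases n.eq_zero_or_pos with rfl | hn
    · simp only [Nat.cast_zero, Real.sqrt_zero, mul_zero, abs_zero]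
    · exact abs_of_nonneg (mul_nonneg (inv_nonneg.2 (ha n hn).le) (Real.sqrt_nonneg _))
  simp only [hsqrt] at hd
  exact hCLT (satisfiesCLT_of_tendsto_mul_sqrt (fun n hn => (inv_pos.2 (ha n hn)).ne') hconv
    hd0.ne' hd)

theorem theorem2 {B : Type*} [NormedAddCommGroup B] [NormedSpace ℝ B] [CompleteSpace B]
    [TopologicalSpace.SeparableSpace B] [MeasurableSpace B] [BorelSpace B]
    {Ω : Type*} [MeasurableSpace Ω] (P : Measure Ω) [IsProbabilityMeasure P]
    (X : Ω → B) (Xs : ℕ → Ω → B)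
    (hX : Measurable X) (hXs : ∀ n, Measurable (Xs n))
    (hindep : iIndepFun Xs P) (hident : ∀ n, IdentDistrib (Xs n) X P P)
    (hCLTSS : SatisfiesCLTSS P Xs) (hCLT : ¬ SatisfiesCLT P Xs)
    (a : ℕ → ℝ) (ha : ∀ n, 0 < n → 0 < a n) :
    ¬ ∃ ν : ProbabilityMeasure B, IsNondegenerate ν ∧
      ConvergesWeaklyTo P (fun n ω => (a n)⁻¹ • partialSum Xs n ω) ν :=
  theorem2_general P Xs hindep (fun n => (hident n).trans (hident 0).symm)
    (fun f => hCLTSS.continuousLinearMap_comp f) hCLT a ha
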